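/- Let $p, q \ge 2$ be coprime integers, let $E \in \mathbb{R}$, and let $V : \mathbb{Z}^2 \to \mathbb{R}$ be $(p,q)$-periodic, i.e. $V(n_1 + p, n_2) = V(n_1, n_2 + q) = V(n_1, n_2)$ for all $(n_1,n_2) \in \mathbb{Z}^2$. Write $e(x) = \mathrm{e}^{2\pi \mathrm{i} x}$ and $$\mathbb{B} = \left\{0, \tfrac1p, \dots, \tfrac{p-1}{p}\right\} \times \left\{0, \tfrac1q, \dots, \tfrac{q-1}{q}\right\} \subseteq (\mathbb{R}/\mathbb{Z})^2, \qquad \widehat{V}(k) = \frac{1}{pq} \sum_{n_1=0}^{p-1} \sum_{n_2=0}^{q-1} V(n_1,n_2)\, e(-k_1 n_1 - k_2 n_2) \quad (k \in \mathbb{B}).$$ For $\theta \in [0,\tfrac1p)$ and $\varphi \in [0,\tfrac1q)$ let $\widehat{H}_{(p,q),(\theta,\varphi)} : \ell^2(\mathbb{B}) \to \ell^2(\mathbb{B})$ be the Floquet operator $$\widehat{H}_{(p,q),(\theta,\varphi)} v(\ell) = \bigl(2\cos(2\pi(\ell_1 + \theta)) + 2\cos(2\pi(\ell_2 + \varphi))\bigr)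 v(\ell) + \sum_{k \in \mathbb{B}} \widehat{V}(k)\, v(\ell - k),$$ where $\ell - k$ is computed modulo $1$ in each coordinate. Then the set $$\left\{ (\theta,\varphi) \in \left[0,\tfrac1p\right) \times \left[0,\tfrac1q\right) :\ E \text{ is an eigenvalue of multiplicity} \ge 2 \text{ of } \widehat{H}_{(p,q),(\theta,\varphi)} \right\}$$ is finite. -/

import Mathlib

namespace Floquet

/-- `V : ℤ² → ℝ` is `(p, q)`-periodic. -/
def IsPeriodic (p q : ℕ) (V : ℤ × ℤ → ℝ) : Prop :=
  ∀ n : ℤ × ℤ, V (n.1 + p, n.2) = V n ∧ V (n.1, n.2 + q) = V n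

/-- `e(x) = exp(2πix)`. -/
noncomputable def e (x : ℝ) : ℂ :=
  Complex.exp (2 * Real.pi * Complex.I * x)

/-- The Fourier coefficient of a `(p, q)`-periodic `V` at the frequency `(k.1 / p, k.2 / q)`.
The set `𝔹 = {0, 1/p, …, (p-1)/p} × {0, 1/q, …, (q-1)/q} ⊆ 𝕋²` of frequencies is indexed by
`Fin p × Fin q`; the sum runs over the fundamental cell `{0, …, p-1} × {0, …, q-1}`. -/
noncomputable def fourierCoeff (p q : ℕ) (V : ℤ × ℤ → ℝ) (k : Fin p × Fin q) : ℂ :=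
  (1 / ((p : ℂ) * (q : ℂ))) * ∑ n : Fin p × Fin q,
    (V ((n.1 : ℕ), (n.2 : ℕ)) : ℂ) *
      e (-(((k.1 : ℕ) : ℝ) / p * ((n.1 : ℕ) : ℝ) + ((k.2 : ℕ) : ℝ) / q * ((n.2 : ℕ) : ℝ)))

/-- The Floquet operator on `ℓ²(𝔹)` at quasimomentum `(θ, φ)`:
`(Ĥ v)(ℓ) = (2 cos 2π(ℓ₁/p + θ) + 2 cos 2π(ℓ₂/q + φ)) v(ℓ) + ∑ₖ V̂(k) v(ℓ - k)`.
Subtraction in `Fin p × Fin q` is modulo `p` and `q`, that is, subtraction in `𝔹 ⊆ 𝕋²`. -/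
noncomputable def floquetOp (p q : ℕ) (V : ℤ × ℤ → ℝ) (θ φ : ℝ) :
    EuclideanSpace ℂ (Fin p × Fin q) →ₗ[ℂ] EuclideanSpace ℂ (Fin p × Fin q) where
  toFun v := WithLp.toLp 2 fun l =>
    ((2 * Real.cos (2 * Real.pi * (((l.1 : ℕ) : ℝ) / p + θ))
      + 2 * Real.cos (2 * Real.pi * (((l.2 : ℕ) : ℝ) / q + φ)) : ℝ) : ℂ) * v l
      + ∑ k : Fin p × Fin q, fourierCoeff p q V k * v (l - k)
  map_add' v w := by
    ext l
    simp only [PiLp.add_apply, mul_add, Finset.sum_add_distrib]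
    ring
  map_smul' c v := by
    ext l
    simp only [PiLp.smul_apply, smul_eq_mul, RingHom.id_apply, mul_add, Finset.mul_sum]
    congr 1
    · ring
    · exact Finset.sum_congr rfl fun k _ => by ring

/-- `E` is an eigenvalue of multiplicity at least two: its eigenspace has dimension at least two.
(For real `V`, `θ`, `φ` the Floquet operator is self-adjoint, so geometric and algebraic
multiplicities agree.) -/
def IsMultipleEigenvalue (p q : ℕ) (V : ℤ × ℤ → ℝ) (θ φ E : ℝ) : Prop :=
  2 ≤ Module.finrank ℂ (Module.End.eigenspace (floquetOp p q V θ φ) (E : ℂ))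

end Floquet

/-! In the multipliers `x = e θ`, `y = e φ`, the operator minus `E` is a constant matrix plus the
diagonal `α x + (α x)⁻¹ + β y + (β y)⁻¹`. A double eigenvalue kills its adjugate, whose entries
become polynomials in `x, y` after scaling by `x * y`. Coprimality makes the ratios `α / β` and the
products `α * β` distinct, so for large `‖x‖`, uniformly in `y ≠ 0`, at most one diagonal entry is
small; the others dominate their rows, and the adjugate is nonzero
(`exists_radius_adjugate_ne_zero`). Elimination (`Polynomial.exists_eliminant`) then confines `x` to
the roots of one polynomial. By symmetry so is `y`, and `e` is injective on `[0, 1)`. -/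

open Polynomial in
/-- If, for infinitely many `x`, finitely many bivariate polynomials have no common zero of the
form `(x, y)`, then the first coordinates of their common zeros are roots of one nonzero
polynomial. -/
theorem Polynomial.exists_eliminant {k ι : Type*} [Field k] [IsAlgClosed k] [Fintype ι]
    (g : ι → k[X][X]) (T : Set k) (hT : T.Infinite)
    (h : ∀ x ∈ T, ∀ y, ∃ i, (g i).evalEval x y ≠ 0) :
    ∃ d : k[X], d ≠ 0 ∧ ∀ x y, (∀ i, (g i).evalEval x y = 0) → d.eval x = 0 := by
  classical
  let _ : Algebra k[X][X] (FractionRing k[X])[X] := Polynomial.algebra _ _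
  have : IsLocalization ((nonZeroDivisors k[X]).map C) (FractionRing k[X])[X] :=
    Polynomial.isLocalization _ _
  have hinj : Function.Injective (algebraMap k[X][X] (FractionRing k[X])[X]) :=
    Polynomial.map_injective _ (IsFractionRing.injective k[X] (FractionRing k[X]))
  set M := (nonZeroDivisors k[X]).map (C : k[X] →+* k[X][X])
  set I : Ideal k[X][X] := Ideal.span (Set.range g)
  have hIzero : ∀ x y, (∀ i, (g i).evalEval x y = 0) → ∀ f ∈ I, f.evalEval x y = 0 := by
    intro x y hxy f hf
    have : I ≤ RingHom.ker (evalEvalRingHom x y) := by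
      rw [Ideal.span_le]
      rintro _ ⟨i, rfl⟩
      exact hxy i
    exact this hf
  obtain ⟨f, hf⟩ := IsPrincipalIdealRing.principal
    (I.map (algebraMap k[X][X] (FractionRing k[X])[X]))
  change _ = Ideal.span {f} at hf
  -- Over the field of fractions in `x` the ideal is generated by `f`. If `f` is a unit, clearing
  -- denominators in `1` gives the eliminant; otherwise its numerator `F` yields common zeros over
  -- `T`.
  by_cases hu : IsUnit f
  · have h1 : (1 : (FractionRing k[X])[X]) ∈ I.map (algebraMap k[X][X] (FractionRing k[X])[X]) := by
      rw [hf, Ideal.span_singleton_eq_top.2 hu]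
      trivial
    obtain ⟨⟨⟨a, ha⟩, ⟨_, d, hd, rfl⟩⟩, e⟩ := (IsLocalization.mem_map_algebraMap_iff M _).1 h1
    rw [one_mul] at e
    replace e : C d = a := hinj e
    refine ⟨d, nonZeroDivisors.ne_zero hd, fun x y hxy => ?_⟩
    have := hIzero x y hxy a ha
    rwa [← e, evalEval_C] at this
  · exfalso
    obtain ⟨⟨F, ⟨_, c, hc, rfl⟩⟩, hF⟩ := IsLocalization.surj M f
    have hdvd : ∀ i, ∃ b : k[X], b ≠ 0 ∧ F ∣ C b * g i := by
      intro i
      have hi : algebraMap _ (FractionRing k[X])[X] (g i) ∈ Ideal.span {f} :=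
        hf ▸ Ideal.mem_map_of_mem _ (Ideal.subset_span ⟨i, rfl⟩)
      obtain ⟨w, hw⟩ := Ideal.mem_span_singleton.1 hi
      obtain ⟨⟨W, ⟨_, b, hb, rfl⟩⟩, hW⟩ := IsLocalization.surj M w
      refine ⟨c * b, mul_ne_zero (nonZeroDivisors.ne_zero hc) (nonZeroDivisors.ne_zero hb),
        W, hinj ?_⟩
      simp only at hF hW
      rw [C_mul, map_mul, map_mul, map_mul, ← hF, ← hW, hw]
      ring
    choose b hb0 hb using hdvd
    -- Where this product is nonzero at `x ∈ T`, `F` keeps its positive degree in `y`, and a root of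
    -- it is a common zero of all `g i`.
    have hprod : F.leadingCoeff * ∏ i, b i = 0 := by
      refine Polynomial.eq_zero_of_infinite_isRoot _ (hT.mono fun x hx => ?_)
      by_contra hne
      simp only [Set.mem_ofPred_eq, IsRoot.def, eval_mul, eval_prod, mul_eq_zero, not_or,
        Finset.prod_eq_zero_iff, Finset.mem_univ, true_and, not_exists] at hne
      obtain ⟨hl, hbx⟩ := hne
      have hdeg : F.degree ≠ 0 := by
        intro h0
        apply hu
        obtain ⟨r, hr⟩ : ∃ r, F = C r := ⟨_, eq_C_of_degree_eq_zero h0⟩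
        have hr0 : r ≠ 0 := by
          rintro rfl
          simp [hr] at h0
        have hr' : IsUnit (algebraMap k[X][X] (FractionRing k[X])[X] F) :=
          IsLocalization.map_units _ (⟨F, r, mem_nonZeroDivisors_of_ne_zero hr0, hr.symm⟩ : M)
        rw [← hF] at hr'
        exact isUnit_of_mul_isUnit_left hr'
      have hdeg' : (F.map (evalRingHom x)).degree ≠ 0 := by
        rwa [degree_map_eq_of_leadingCoeff_ne_zero _ (by simpa using hl)]
      obtain ⟨y, hy⟩ := IsAlgClosed.exists_root _ hdeg'
      obtain ⟨i, hi⟩ := h x hx y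
      have hFy : F.evalEval x y = 0 := by
        rw [← map_evalRingHom_eval]
        exact hy
      have := evalEval_dvd x y (hb i)
      rw [hFy, zero_dvd_iff, evalEval_mul, evalEval_C] at this
      exact (mul_ne_zero (hbx i) hi) this
    have hF0 : F = 0 := by
      rcases mul_eq_zero.1 hprod with h0 | h0
      · exact leadingCoeff_eq_zero.1 h0
      · exact absurd h0 (Finset.prod_ne_zero_iff.2 fun i _ => hb0 i)
    obtain ⟨x, hx⟩ := (hT.sdiff (Polynomial.finite_setOfPred_isRoot (p := ∏ i, b i)
      (Finset.prod_ne_zero_iff.2 fun i _ => hb0 i))).nonempty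
    obtain ⟨i, hi⟩ := h x hx.1 0
    have := hb i
    rw [hF0, zero_dvd_iff, mul_eq_zero, C_eq_zero] at this
    rcases this with h0 | h0
    · exact hb0 i h0
    · simp [h0] at hi

/-! ### Vanishing of the adjugate -/

/-- A matrix whose kernel has dimension at least two has zero adjugate. -/
theorem Matrix.adjugate_eq_zero_of_two_le_finrank_ker {K n : Type*} [Field K] [Fintype n]
    [DecidableEq n] (A : Matrix n n K)
    (h : 2 ≤ Module.finrank K (LinearMap.ker A.toLin')) : A.adjugate = 0 := by
  ext i j
  rw [Matrix.adjugate_apply, Matrix.zero_apply, ← Matrix.exists_mulVec_eq_zero_iff]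
  -- A kernel vector with zero `i`-th coordinate is also killed by the row that replaces row `j`.
  let f : LinearMap.ker A.toLin' →ₗ[K] K :=
    (LinearMap.proj i : (n → K) →ₗ[K] K) ∘ₗ (LinearMap.ker A.toLin').subtype
  have hf : LinearMap.ker f ≠ ⊥ := f.ker_ne_bot_of_finrank_lt (by rw [Module.finrank_self]; omega)
  obtain ⟨v, hv, hv0⟩ := Submodule.exists_mem_ne_zero_of_ne_bot hf
  refine ⟨v.1, fun h0 => hv0 (Subtype.ext h0), ?_⟩
  have hAv : A.mulVec v.1 = 0 := LinearMap.mem_ker.1 v.2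
  have hvi : v.1 i = 0 := hv
  ext l
  by_cases hl : l = j
  · subst hl
    simp [Matrix.mulVec, hvi]
  · simpa [Matrix.mulVec, Matrix.updateRow_ne hl] using congrFun hAv l

/-- If all diagonal entries but one dominate their rows, the adjugate does not vanish. -/
theorem Matrix.adjugate_ne_zero_of_dominant {n : Type*} [Fintype n] [DecidableEq n]
    (A : Matrix n n ℂ) (a : n)
    (h : ∀ b, b ≠ a → ∑ c ∈ Finset.univ.erase b, ‖A b c‖ < ‖A b b‖) : A.adjugate ≠ 0 := by
  intro h0
  have hd : (A.updateRow a (Pi.single a 1)).det ≠ 0 := by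
    apply det_ne_zero_of_sum_row_lt_diag
    intro b
    by_cases hb : b = a
    · subst hb
      rw [Finset.sum_eq_zero]
      · simp
      · intro c hc
        simp [Finset.ne_of_mem_erase hc]
    · simpa [Matrix.updateRow_ne hb] using h b hb
  rw [← Matrix.adjugate_apply, h0] at hd
  exact hd rfl

/-! ### The symbol at complex multipliers -/

namespace Floquet

section Symbol

variable {ι : Type*} [DecidableEq ι] (α β : ι → ℂ) (A : Matrix ι ι ℂ)

/-- The matrix of the Floquet operator, shifted by the energy, at complex multipliers. -/
noncomputable def symbolMatrix (x y : ℂ) : Matrix ι ι ℂ :=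
  Matrix.diagonal (fun i => α i * x + (α i * x)⁻¹ + (β i * y + (β i * y)⁻¹)) + A

theorem symbolMatrix_swap (x y : ℂ) : symbolMatrix α β A x y = symbolMatrix β α A y x := by
  simp only [symbolMatrix, add_comm (α _ * x + (α _ * x)⁻¹)]

open Polynomial in
/-- The polynomial matrix whose value at `(x, y)` is `x * y` times the symbol matrix. -/
noncomputable def polySymbolMatrix : Matrix ι ι ℂ[X][X] :=
  Matrix.diagonal (fun i => X * C (C (α i) * X ^ 2 + C (α i)⁻¹)
    + C X * (C (C (β i)) * X ^ 2 + C (C (β i)⁻¹))) + A.map fun a => C (C a * X) * X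

open Polynomial in
theorem polySymbolMatrix_map_apply (x y : ℂ) (i j : ι) :
    (polySymbolMatrix α β A).map (evalEvalRingHom x y) i j =
      (if i = j then y * (α i * x ^ 2 + (α i)⁻¹) + x * (β i * y ^ 2 + (β i)⁻¹) else 0)
        + A i j * x * y := by
  by_cases hij : i = j
  · subst hij
    simp [polySymbolMatrix]
  · simp [polySymbolMatrix, hij]

open Polynomial in
theorem polySymbolMatrix_map (hα : ∀ i, α i ≠ 0) (hβ : ∀ i, β i ≠ 0) {x y : ℂ}
    (hx : x ≠ 0) (hy : y ≠ 0) :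
    (polySymbolMatrix α β A).map (evalEvalRingHom x y) = (x * y) • symbolMatrix α β A x y := by
  ext i j
  rw [polySymbolMatrix_map_apply]
  have := hα i
  have := hβ i
  by_cases hij : i = j
  · subst hij
    simp [symbolMatrix]
    field_simp
  · simp [symbolMatrix, hij]
    ring

variable [Fintype ι]

-- Clearing denominators adds the line `y = 0`; there the matrix is diagonal and invertible, so no
-- spurious common zeros arise for `x ≠ 0`.
open Polynomial in
theorem adjugate_polySymbolMatrix_map_zero_ne (hβ : ∀ i, β i ≠ 0) [Nonempty ι] {x : ℂ}
    (hx : x ≠ 0) : ((polySymbolMatrix α β A).map (evalEvalRingHom x 0)).adjugate ≠ 0 := by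
  have hN : (polySymbolMatrix α β A).map (evalEvalRingHom x 0)
      = Matrix.diagonal fun i => x * (β i)⁻¹ := by
    ext i j
    rw [polySymbolMatrix_map_apply]
    by_cases hij : i = j <;> simp [hij]
  intro h0
  have hm := Matrix.mul_adjugate (Matrix.diagonal fun i => x * (β i)⁻¹)
  rw [← hN, h0, hN, Matrix.mul_zero, Matrix.det_diagonal] at hm
  obtain ⟨i⟩ := ‹Nonempty ι›
  have := congrFun (congrFun hm i) i
  simp only [Matrix.zero_apply, Matrix.smul_apply, Matrix.one_apply_eq, smul_eq_mul,
    mul_one] at this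
  exact Finset.prod_ne_zero_iff.2 (fun i _ => mul_ne_zero hx (inv_ne_zero (hβ i))) this.symm

variable {α β}

theorem norm_mul_div_sub_le {a b x y : ℂ} {K : ℝ} (ha : ‖a‖ = 1) (hb : ‖b‖ = 1)
    (hx : 1 ≤ ‖x‖) (hy : 1 ≤ ‖y‖) (h : ‖a * x + (a * x)⁻¹ + (b * y + (b * y)⁻¹)‖ ≤ K) :
    ‖a / b * x + y‖ ≤ K + 2 := by
  have hb0 : b ≠ 0 := by
    rintro rfl
    simp at hb
  have h1 : ‖(a * x)⁻¹‖ ≤ 1 := by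
    rw [norm_inv, norm_mul, ha, one_mul]
    exact inv_le_one_of_one_le₀ hx
  have h2 : ‖(b * y)⁻¹‖ ≤ 1 := by
    rw [norm_inv, norm_mul, hb, one_mul]
    exact inv_le_one_of_one_le₀ hy
  calc ‖a / b * x + y‖ = ‖b * (a / b * x + y)‖ := by rw [norm_mul, hb, one_mul]
    _ = ‖(a * x + (a * x)⁻¹ + (b * y + (b * y)⁻¹)) - (a * x)⁻¹ - (b * y)⁻¹‖ := by
      congr 1
      rw [mul_add, ← mul_assoc, mul_div_cancel₀ _ hb0]
      ring
    _ ≤ _ := by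
      have := norm_sub_le (a * x + (a * x)⁻¹ + (b * y + (b * y)⁻¹) - (a * x)⁻¹) (b * y)⁻¹
      have := norm_sub_le (a * x + (a * x)⁻¹ + (b * y + (b * y)⁻¹)) (a * x)⁻¹
      linarith

/-- Subtracting the bounds on `α / β * x + y` for two indices cancels `y` and bounds `‖x‖`. -/
theorem exists_radius_of_one_le (hα : ∀ i, ‖α i‖ = 1) (hβ : ∀ i, ‖β i‖ = 1)
    (hdiv : Function.Injective fun i => α i / β i) (K : ℝ) :
    ∃ R : ℝ, ∀ x y : ℂ, R < ‖x‖ → 1 ≤ ‖y‖ → ∀ i j,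
      ‖α i * x + (α i * x)⁻¹ + (β i * y + (β i * y)⁻¹)‖ ≤ K →
      ‖α j * x + (α j * x)⁻¹ + (β j * y + (β j * y)⁻¹)‖ ≤ K → i = j := by
  let r : ι × ι → ℝ := fun ij => (2 * K + 4) / ‖α ij.1 / β ij.1 - α ij.2 / β ij.2‖
  obtain ⟨R, hR⟩ := (Set.finite_range r).bddAbove
  refine ⟨max R 1, fun x y hx hy i j hi hj => ?_⟩
  by_contra hij
  have hx1 : 1 ≤ ‖x‖ := (le_max_right _ _).trans hx.le
  have hi' := norm_mul_div_sub_le (hα i) (hβ i) hx1 hy hi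
  have hj' := norm_mul_div_sub_le (hα j) (hβ j) hx1 hy hj
  have hpos : 0 < ‖α i / β i - α j / β j‖ :=
    norm_pos_iff.2 (sub_ne_zero.2 fun h => hij (hdiv h))
  have hlt : (2 * K + 4) / ‖α i / β i - α j / β j‖ < ‖x‖ :=
    (hR ⟨(i, j), rfl⟩).trans_lt ((le_max_left _ _).trans_lt hx)
  rw [div_lt_iff₀ hpos, ← norm_mul] at hlt
  have := norm_sub_le (α i / β i * x + y) (α j / β j * x + y)
  rw [show α i / β i * x + y - (α j / β j * x + y) = x * (α i / β i - α j / β j) by ring] at this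
  linarith

/-- The diagonal is unchanged under `y ↦ y⁻¹`, `β ↦ β⁻¹`, which reduces `‖y‖ ≤ 1` to `1 ≤ ‖y‖` and
turns ratios into products. -/
theorem exists_radius (hα : ∀ i, ‖α i‖ = 1) (hβ : ∀ i, ‖β i‖ = 1)
    (hdiv : Function.Injective fun i => α i / β i)
    (hmul : Function.Injective fun i => α i * β i) (K : ℝ) :
    ∃ R : ℝ, ∀ x y : ℂ, R < ‖x‖ → y ≠ 0 → ∀ i j,
      ‖α i * x + (α i * x)⁻¹ + (β i * y + (β i * y)⁻¹)‖ ≤ K →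
      ‖α j * x + (α j * x)⁻¹ + (β j * y + (β j * y)⁻¹)‖ ≤ K → i = j := by
  obtain ⟨R₁, h₁⟩ := exists_radius_of_one_le hα hβ hdiv K
  obtain ⟨R₂, h₂⟩ := exists_radius_of_one_le (β := fun i => (β i)⁻¹) hα
    (fun i => by rw [norm_inv, hβ, inv_one]) (by simpa using hmul) K
  refine ⟨max R₁ R₂, fun x y hx hy i j hi hj => ?_⟩
  rcases le_total 1 ‖y‖ with h | h
  · exact h₁ x y ((le_max_left _ _).trans_lt hx) h i j hi hj
  · refine h₂ x y⁻¹ ((le_max_right _ _).trans_lt hx) ?_ i j ?_ ?_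
    · rw [norm_inv]
      exact (one_le_inv₀ (norm_pos_iff.2 hy)).2 h
    · rwa [← mul_inv, inv_inv, add_comm (β i * y)⁻¹]
    · rwa [← mul_inv, inv_inv, add_comm (β j * y)⁻¹]

theorem exists_radius_adjugate_ne_zero [Nonempty ι] (hα : ∀ i, ‖α i‖ = 1) (hβ : ∀ i, ‖β i‖ = 1)
    (hdiv : Function.Injective fun i => α i / β i)
    (hmul : Function.Injective fun i => α i * β i) :
    ∃ R : ℝ, ∀ x y : ℂ, R < ‖x‖ → y ≠ 0 → (symbolMatrix α β A x y).adjugate ≠ 0 := by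
  -- Bounds every full row sum of `A`, including the diagonal entry of `A` that may offset the
  -- symbol.
  let K : ℝ := ∑ i, ∑ j, ‖A i j‖
  obtain ⟨R, hR⟩ := exists_radius hα hβ hdiv hmul K
  refine ⟨R, fun x y hx hy => ?_⟩
  obtain ⟨a, ha⟩ : ∃ a, ∀ b, b ≠ a →
      K < ‖α b * x + (α b * x)⁻¹ + (β b * y + (β b * y)⁻¹)‖ := by
    by_cases hex : ∃ a, ‖α a * x + (α a * x)⁻¹ + (β a * y + (β a * y)⁻¹)‖ ≤ K
    · obtain ⟨a, ha⟩ := hex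
      exact ⟨a, fun b hb => lt_of_not_ge fun h => hb (hR x y hx hy b a h ha)⟩
    · push Not at hex
      exact ⟨Classical.arbitrary ι, fun b _ => hex b⟩
  refine Matrix.adjugate_ne_zero_of_dominant _ a fun b hb => ?_
  have hrow : ∑ c, ‖A b c‖ ≤ K :=
    Finset.single_le_sum (f := fun i => ∑ j, ‖A i j‖)
      (fun i _ => Finset.sum_nonneg fun j _ => norm_nonneg _) (Finset.mem_univ b)
  rw [← Finset.add_sum_erase _ _ (Finset.mem_univ b)] at hrow
  have hsum : ∑ c ∈ Finset.univ.erase b, ‖symbolMatrix α β A x y b c‖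
      = ∑ c ∈ Finset.univ.erase b, ‖A b c‖ :=
    Finset.sum_congr rfl fun c hc => by simp [symbolMatrix, (Finset.ne_of_mem_erase hc).symm]
  have hdiag : ‖α b * x + (α b * x)⁻¹ + (β b * y + (β b * y)⁻¹)‖
      ≤ ‖symbolMatrix α β A x y b b‖ + ‖A b b‖ := by
    refine le_of_eq_of_le ?_ (norm_sub_le _ _)
    simp [symbolMatrix]
  rw [hsum]
  linarith [ha b hb]

open Polynomial in
/-- The first multipliers at which the adjugate of the symbol matrix can vanish are roots of one
nonzero polynomial. -/
theorem exists_polynomial_of_adjugate_eq_zero [Nonempty ι] (hα : ∀ i, ‖α i‖ = 1)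
    (hβ : ∀ i, ‖β i‖ = 1) (hdiv : Function.Injective fun i => α i / β i)
    (hmul : Function.Injective fun i => α i * β i) :
    ∃ d : ℂ[X], d ≠ 0 ∧ ∀ x y : ℂ, x ≠ 0 → y ≠ 0 →
      (symbolMatrix α β A x y).adjugate = 0 → d.eval x = 0 := by
  have hα0 : ∀ i, α i ≠ 0 := fun i => norm_ne_zero_iff.1 (by simp [hα])
  have hβ0 : ∀ i, β i ≠ 0 := fun i => norm_ne_zero_iff.1 (by simp [hβ])
  obtain ⟨R, hR⟩ := exists_radius_adjugate_ne_zero A hα hβ hdiv hmul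
  have hT : {x : ℂ | max R 0 < ‖x‖}.Infinite := by
    refine Set.infinite_of_injective_forall_mem (f := fun n : ℕ => ((max R 0 + 1 + n : ℝ) : ℂ))
      (fun m n h => by simpa using h) fun n => ?_
    have h0 : 0 ≤ max R 0 := le_max_right _ _
    rw [Set.mem_ofPred_eq, Complex.norm_real, Real.norm_of_nonneg (by positivity)]
    have : (0 : ℝ) ≤ n := n.cast_nonneg
    linarith
  have hadj : ∀ x y : ℂ, (∀ ij : ι × ι,
      ((polySymbolMatrix α β A).adjugate ij.1 ij.2).evalEval x y = 0) ↔
        ((polySymbolMatrix α β A).map (evalEvalRingHom x y)).adjugate = 0 := by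
    intro x y
    rw [← RingHom.mapMatrix_apply, ← RingHom.map_adjugate]
    constructor
    · intro h
      ext i j
      exact h (i, j)
    · intro h ij
      exact congrFun (congrFun h ij.1) ij.2
  obtain ⟨d, hd, hd'⟩ := Polynomial.exists_eliminant
    (fun ij : ι × ι => (polySymbolMatrix α β A).adjugate ij.1 ij.2) _ hT (by
      intro x hx y
      by_contra! hcon
      rw [hadj] at hcon
      have hx0 : x ≠ 0 := norm_pos_iff.1 ((le_max_right _ _).trans_lt hx)
      by_cases hy : y = 0
      · subst hy
        exact adjugate_polySymbolMatrix_map_zero_ne α β A hβ0 hx0 hcon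
      · rw [polySymbolMatrix_map α β A hα0 hβ0 hx0 hy, Matrix.adjugate_smul] at hcon
        exact hR x y ((le_max_left _ _).trans_lt hx) hy
          ((smul_eq_zero.1 hcon).resolve_left (pow_ne_zero _ (mul_ne_zero hx0 hy))))
  refine ⟨d, hd, fun x y hx hy h => hd' x y ((hadj x y).2 ?_)⟩
  rw [polySymbolMatrix_map α β A hα0 hβ0 hx hy, Matrix.adjugate_smul, h, smul_zero]

end Symbol

/-! ### Characters and coprimality -/

theorem e_ne_zero (x : ℝ) : e x ≠ 0 := Complex.exp_ne_zero _

theorem norm_e (x : ℝ) : ‖e x‖ = 1 := by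
  rw [e, show 2 * (Real.pi : ℂ) * Complex.I * x = ((2 * Real.pi * x : ℝ) : ℂ) * Complex.I by
    push_cast; ring, Complex.norm_exp_ofReal_mul_I]

theorem e_add (x y : ℝ) : e (x + y) = e x * e y := by
  rw [e, e, e, ← Complex.exp_add]
  push_cast
  ring_nf

theorem e_sub (x y : ℝ) : e (x - y) = e x / e y := by
  rw [eq_div_iff (e_ne_zero y), ← e_add, sub_add_cancel]

theorem e_eq_one_iff (x : ℝ) : e x = 1 ↔ ∃ n : ℤ, x = n := by
  rw [e, Complex.exp_eq_one_iff]
  refine exists_congr fun n => ?_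
  rw [show 2 * (Real.pi : ℂ) * Complex.I * x = x * (2 * Real.pi * Complex.I) by ring,
    mul_left_inj' Complex.two_pi_I_ne_zero]
  exact_mod_cast Iff.rfl

theorem e_eq_e_iff (x y : ℝ) : e x = e y ↔ ∃ n : ℤ, x - y = n := by
  rw [← e_eq_one_iff, e_sub, div_eq_one_iff_eq (e_ne_zero y)]

theorem e_injOn : Set.InjOn e (Set.Ico 0 1) := by
  intro x hx y hy h
  obtain ⟨n, hn⟩ := (e_eq_e_iff x y).1 h
  have h1 : (n : ℝ) < 1 := by linarith [hx.2, hy.1]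
  have h2 : (-1 : ℝ) < n := by linarith [hx.1, hy.2]
  have : n = 0 := by
    have : n < 1 := by exact_mod_cast h1
    have : -1 < n := by exact_mod_cast h2
    omega
  rw [this] at hn
  simpa [sub_eq_zero] using hn

theorem two_cos_eq (x : ℝ) : ((2 * Real.cos (2 * Real.pi * x) : ℝ) : ℂ) = e x + (e x)⁻¹ := by
  rw [e, ← Complex.exp_neg]
  push_cast
  rw [Complex.two_cos]
  ring_nf

theorem fin_ext_of_dvd_mul {p q : ℕ} (hpq : Nat.Coprime p q) {j j' : Fin p}
    (h : (p : ℤ) ∣ q * ((j : ℤ) - j')) : j = j' := by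
  have hd : (p : ℤ) ∣ (j : ℤ) - j' :=
    (Nat.isCoprime_iff_coprime.2 hpq).dvd_of_dvd_mul_left h
  have h0 := Int.eq_zero_of_abs_lt_dvd hd (by
    rw [abs_lt]
    have := j.2
    have := j'.2
    omega)
  ext
  omega

theorem injective_e_add {p q : ℕ} (hp : 0 < p) (hq : 0 < q) (hpq : Nat.Coprime p q) :
    Function.Injective fun l : Fin p × Fin q =>
      e (((l.1 : ℕ) : ℝ) / p) * e (((l.2 : ℕ) : ℝ) / q) := by
  rintro ⟨j, k⟩ ⟨j', k'⟩ h
  simp only [← e_add] at h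
  obtain ⟨n, hn⟩ := (e_eq_e_iff _ _).1 h
  have hp' : (p : ℝ) ≠ 0 := by positivity
  have hq' : (q : ℝ) ≠ 0 := by positivity
  field_simp at hn
  have hn' : (q : ℤ) * ((j : ℤ) - j') + p * ((k : ℤ) - k') = p * q * n := by
    have : (q : ℝ) * ((j : ℝ) - j') + p * ((k : ℝ) - k') = p * q * n := by linarith
    exact_mod_cast this
  have h1 : j = j' := fin_ext_of_dvd_mul hpq ⟨q * n - ((k : ℤ) - k'), by linarith⟩
  have h2 : k = k' := fin_ext_of_dvd_mul hpq.symm ⟨p * n - ((j : ℤ) - j'), by linarith⟩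
  rw [h1, h2]

theorem injective_e_sub {p q : ℕ} (hp : 0 < p) (hq : 0 < q) (hpq : Nat.Coprime p q) :
    Function.Injective fun l : Fin p × Fin q =>
      e (((l.1 : ℕ) : ℝ) / p) / e (((l.2 : ℕ) : ℝ) / q) := by
  rintro ⟨j, k⟩ ⟨j', k'⟩ h
  simp only [← e_sub] at h
  obtain ⟨n, hn⟩ := (e_eq_e_iff _ _).1 h
  have hp' : (p : ℝ) ≠ 0 := by positivity
  have hq' : (q : ℝ) ≠ 0 := by positivity
  field_simp at hn
  have hn' : (q : ℤ) * ((j : ℤ) - j') - p * ((k : ℤ) - k') = p * q * n := by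
    have : (q : ℝ) * ((j : ℝ) - j') - p * ((k : ℝ) - k') = p * q * n := by linarith
    exact_mod_cast this
  have h1 : j = j' := fin_ext_of_dvd_mul hpq ⟨q * n + ((k : ℤ) - k'), by linarith⟩
  have h2 : k = k' := fin_ext_of_dvd_mul hpq.symm ⟨((j : ℤ) - j') - p * n, by linarith⟩
  rw [h1, h2]

/-! ### The Floquet operator as a symbol matrix -/

/-- The potential part of the Floquet operator as a matrix, shifted by the energy. -/
noncomputable def potentialMatrix (p q : ℕ) (V : ℤ × ℤ → ℝ) (E : ℝ) :
    Matrix (Fin p × Fin q) (Fin p × Fin q) ℂ :=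
  Matrix.of (fun l m => fourierCoeff p q V (l - m)) - Matrix.scalar _ (E : ℂ)

theorem symbolMatrix_mulVec {p q : ℕ} (hp : 0 < p) (hq : 0 < q) (V : ℤ × ℤ → ℝ) (θ φ E : ℝ)
    (v : EuclideanSpace ℂ (Fin p × Fin q)) :
    (symbolMatrix (fun l : Fin p × Fin q => e (((l.1 : ℕ) : ℝ) / p))
      (fun l => e (((l.2 : ℕ) : ℝ) / q)) (potentialMatrix p q V E) (e θ) (e φ)).mulVec v.ofLp =
      (floquetOp p q V θ φ v - (E : ℂ) • v).ofLp := by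
  have : NeZero p := ⟨hp.ne'⟩
  have : NeZero q := ⟨hq.ne'⟩
  ext l
  have hsum : ∑ k : Fin p × Fin q, fourierCoeff p q V k * v (l - k)
      = ∑ m, fourierCoeff p q V (l - m) * v m := by
    rw [← Equiv.sum_comp (Equiv.subLeft l)]
    simp
  have hmul : (Matrix.of fun l m => fourierCoeff p q V (l - m)).mulVec v.ofLp l
      = ∑ m, fourierCoeff p q V (l - m) * v m := rfl
  rw [symbolMatrix, potentialMatrix, Matrix.add_mulVec, Matrix.sub_mulVec, Pi.add_apply,
    Pi.sub_apply, hmul, Matrix.mulVec_diagonal, Matrix.scalar_apply, Matrix.mulVec_diagonal,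
    ← e_add, ← e_add]
  simp only [floquetOp, LinearMap.coe_mk, AddHom.coe_mk, PiLp.sub_apply, PiLp.smul_apply, hsum,
    Complex.ofReal_add, two_cos_eq, smul_eq_mul]
  ring

theorem adjugate_eq_zero_of_isMultipleEigenvalue {p q : ℕ} (hp : 0 < p) (hq : 0 < q)
    {V : ℤ × ℤ → ℝ} {θ φ E : ℝ} (h : IsMultipleEigenvalue p q V θ φ E) :
    (symbolMatrix (fun l : Fin p × Fin q => e (((l.1 : ℕ) : ℝ) / p))
      (fun l => e (((l.2 : ℕ) : ℝ) / q)) (potentialMatrix p q V E) (e θ) (e φ)).adjugate = 0 := by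
  refine Matrix.adjugate_eq_zero_of_two_le_finrank_ker _ (le_of_le_of_eq h ?_)
  have key : LinearMap.ker (Matrix.toLin' (symbolMatrix
      (fun l : Fin p × Fin q => e (((l.1 : ℕ) : ℝ) / p)) (fun l => e (((l.2 : ℕ) : ℝ) / q))
      (potentialMatrix p q V E) (e θ) (e φ))) =
      (Module.End.eigenspace (floquetOp p q V θ φ) (E : ℂ)).map
        (WithLp.linearEquiv 2 ℂ (Fin p × Fin q → ℂ)).toLinearMap := by
    ext w
    rw [Submodule.mem_map_equiv, LinearMap.mem_ker, Matrix.toLin'_apply,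
      Module.End.mem_eigenspace_iff,
      show w = ((WithLp.linearEquiv 2 ℂ (Fin p × Fin q → ℂ)).symm w).ofLp from rfl,
      symbolMatrix_mulVec hp hq]
    exact (WithLp.ofLp_eq_zero 2).trans sub_eq_zero
  rw [key]
  exact (LinearEquiv.finrank_map_eq _ _).symm

theorem finite_setOf_eval_e_eq_zero {d : Polynomial ℂ} (hd : d ≠ 0) :
    {t : ℝ | t ∈ Set.Ico (0 : ℝ) 1 ∧ d.eval (e t) = 0}.Finite :=
  Set.Finite.of_finite_image
    ((Polynomial.finite_setOfPred_isRoot hd).subset (by rintro _ ⟨t, ht, rfl⟩; exact ht.2))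
    (e_injOn.mono fun _ ht => ht.1)

end Floquet

theorem mainTheorem3 (p q : ℕ) (hp : 2 ≤ p) (hq : 2 ≤ q) (hpq : Nat.Coprime p q)
    (V : ℤ × ℤ → ℝ) (hV : Floquet.IsPeriodic p q V) (E : ℝ) :
    {x : ℝ × ℝ | x.1 ∈ Set.Ico (0 : ℝ) (1 / p) ∧ x.2 ∈ Set.Ico (0 : ℝ) (1 / q) ∧
      Floquet.IsMultipleEigenvalue p q V x.1 x.2 E}.Finite := by
  open Floquet in
  have hp0 : 0 < p := by omega
  have hq0 : 0 < q := by omega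
  have : NeZero p := ⟨hp0.ne'⟩
  have : NeZero q := ⟨hq0.ne'⟩
  have hdiv := injective_e_sub hp0 hq0 hpq
  have hmul := injective_e_add hp0 hq0 hpq
  obtain ⟨d₁, hd₁, h₁⟩ := exists_polynomial_of_adjugate_eq_zero (potentialMatrix p q V E)
    (fun _ => norm_e _) (fun _ => norm_e _) hdiv hmul
  -- Exchanging the coordinates inverts the ratios and preserves the products.
  obtain ⟨d₂, hd₂, h₂⟩ := exists_polynomial_of_adjugate_eq_zero (potentialMatrix p q V E)
    (α := fun l : Fin p × Fin q => e (((l.2 : ℕ) : ℝ) / q))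
    (β := fun l : Fin p × Fin q => e (((l.1 : ℕ) : ℝ) / p))
    (fun _ => norm_e _) (fun _ => norm_e _)
    (fun l m h => hdiv (by simpa using congrArg (·⁻¹) h))
    (fun l m h => hmul (by simpa only [mul_comm] using h))
  have hle : ∀ n : ℕ, 0 < n → Set.Ico (0 : ℝ) (1 / n) ⊆ Set.Ico 0 1 := fun n hn =>
    Set.Ico_subset_Ico_right ((div_le_one (by positivity)).2 (by exact_mod_cast hn))
  refine ((finite_setOf_eval_e_eq_zero hd₁).prod (finite_setOf_eval_e_eq_zero hd₂)).subset ?_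
  rintro ⟨θ, φ⟩ ⟨hθ, hφ, hm⟩
  have hadj := adjugate_eq_zero_of_isMultipleEigenvalue hp0 hq0 hm
  refine ⟨⟨hle p hp0 hθ, h₁ _ _ (e_ne_zero θ) (e_ne_zero φ) hadj⟩,
    ⟨hle q hq0 hφ, h₂ _ _ (e_ne_zero φ) (e_ne_zero θ) ?_⟩⟩
  rwa [symbolMatrix_swap]
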